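/- For an integer $m\ge 2$ and $\varepsilon=\pm1$ let $V=\mathbb F_2^{2m}$ and $$Q(x)=x_1x_2+\cdots+x_{2m-3}x_{2m-2}+f(x_{2m-1},x_{2m}),$$ where $f(a,b)=ab$ if $\varepsilon=1$ and $f(a,b)=a^2+ab+b^2$ if $\varepsilon=-1$. The affine polar graph $\mathrm{VO}^{\varepsilon}_{2m}(2)$ has vertex set $V$, two distinct vectors $u,v$ being adjacent if and only if $Q(u-v)=0$. For a finite graph $\Gamma$ on a vertex set $\Omega$, let $A_0=I$, and let $A_1$ and $A_2$ be the adjacency matrices of $\Gamma$ and of its complement. For $\omega\in\Omega$ and $i\in\{0,1,2\}$ let $E^*_{i,\omega}$ be the diagonal matrix with $(\alpha,\alpha)$-entry $A_i(\omega,\alpha)$. Put $$T_{0,\omega}=\operatorname{Span}_{\mathbb C}\{E^*_{i,\omega}A_jE^*_{k,\omega}: i,j,k\in\{0,1,2\}\},$$ let $T_\omega$ be the subalgebra of $\mathrm{Mat}_{\Omega}(\mathbb C)$ generated by $A_0,A_1,A_2,E^*_{0,\omega},E^*_{1,\omega},E^*_{2,\omega}$, and let $\widetilde T_\omega$ be the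 algebra of all complex matrices that commute with the permutation matrix of every automorphism of $\Gamma$ fixing $\omega$. A strongly regular graph $\Gamma$ is called triply-transitive if it is vertex-transitive and $T_{0,\omega}=T_\omega=\widetilde T_\omega$ for every vertex $\omega$. **Theorem.** Let $m\ge2$ and $\varepsilon=\pm1$. 1. The graph $\mathrm{VO}^{\varepsilon}_{2m}(2)$ is a triply-transitive strongly regular graph. 2. For every vertex $\omega$ of this graph, $\dim T_{0,\omega}=\dim\widetilde T_\omega=14$ if $(m,\varepsilon)=(2,-1)$, and $\dim T_{0,\omega}=\dim\widetilde T_\omega=15$ in all other cases. 3. If $m\ge3$, then the group $H_2$ of all automorphisms of $\mathrm{VO}^{\varepsilon}_{2m}(2)$ that fix both $0$ and $e_1+e_2=(1,1,0,\dots,0)$ has exactly two orbits on the set of neighbours of $0$. -/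

import Mathlib

namespace SimpleGraph

variable {V : Type*} [Fintype V] [DecidableEq V] (G : SimpleGraph V) [DecidableRel G.Adj]

/-- `G` is strongly regular (for some parameters). -/
def IsStronglyRegular : Prop :=
  ∃ n k l μ : ℕ, G.IsSRGWith n k l μ

/-- The automorphism group of `G` is transitive on the vertices. -/
def IsVertexTransitive {V : Type*} (G : SimpleGraph V) : Prop :=
  ∀ u v : V, ∃ g : G ≃g G, g u = v

/-- The matrices `A₀ = I`, `A₁`, `A₂` of the relations equality, adjacency and
distinct non-adjacency. -/
noncomputable def schemeMatrix : Fin 3 → Matrix V V ℂ :=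
  ![1, G.adjMatrix ℂ, Gᶜ.adjMatrix ℂ]

/-- The dual idempotent `E*_{i,ω}`: the diagonal matrix whose `(α,α)` entry is `1` if
`(ω,α) ∈ R_i` and `0` otherwise, that is, the projection onto the `i`-th subconstituent. -/
noncomputable def dualIdempotent (ω : V) (i : Fin 3) : Matrix V V ℂ :=
  Matrix.diagonal fun α => G.schemeMatrix i ω α

/-- The space `T_{0,ω}` spanned by the products `E*_{i,ω} A_j E*_{k,ω}`. -/
noncomputable def tripleSpan (ω : V) : Submodule ℂ (Matrix V V ℂ) :=
  Submodule.span ℂ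
    {X | ∃ i j k : Fin 3, X = G.dualIdempotent ω i * G.schemeMatrix j * G.dualIdempotent ω k}

/-- The Terwilliger algebra `T_ω`, generated by all `A_i` and all `E*_{i,ω}`. -/
noncomputable def terwilligerAlgebra (ω : V) : Subalgebra ℂ (Matrix V V ℂ) :=
  Algebra.adjoin ℂ (Set.range G.schemeMatrix ∪ Set.range (G.dualIdempotent ω))

/-- The centralizer algebra of the stabilizer of `ω` in the automorphism group of `G`:
all complex matrices commuting with the permutation matrices of the automorphisms fixing `ω`. -/
noncomputable def stabilizerCentralizer {V : Type*} [Fintype V] [DecidableEq V]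
    (G : SimpleGraph V) (ω : V) : Subalgebra ℂ (Matrix V V ℂ) :=
  Subalgebra.centralizer ℂ
    {P | ∃ g : G ≃g G, g ω = ω ∧ P = Equiv.Perm.permMatrix ℂ g.toEquiv}

/-- A triply-transitive strongly regular graph: it is strongly regular, vertex-transitive, and
the three spaces above coincide at every vertex. -/
def IsTriplyTransitive : Prop :=
  G.IsStronglyRegular ∧ G.IsVertexTransitive ∧
    ∀ ω : V, G.tripleSpan ω = Subalgebra.toSubmodule (G.terwilligerAlgebra ω) ∧
      G.terwilligerAlgebra ω = G.stabilizerCentralizer ω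

end SimpleGraph

namespace AffinePolar

/-- The vector space `𝔽₂^{2m}`. -/
abbrev Vec (m : ℕ) : Type := Fin (2 * m) → ZMod 2

/-- The binary form on the last two coordinates: `ab` for `ε = 1`, `a² + ab + b²` for `ε = -1`. -/
def lastForm (ε : ℤˣ) (a b : ZMod 2) : ZMod 2 :=
  if ε = 1 then a * b else a ^ 2 + a * b + b ^ 2

/-- The quadratic form `x₁x₂ + ⋯ + x_{2m-3}x_{2m-2} + f(x_{2m-1}, x_{2m})` on `𝔽₂^{2m}`, with `f`
the form `lastForm ε`. Coordinates are numbered from `0` here, and the summand `i = m - 1` is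
the last pair. -/
def quadForm (m : ℕ) (ε : ℤˣ) (x : Vec m) : ZMod 2 :=
  ∑ i : Fin m,
    if (i : ℕ) + 1 = m then
      lastForm ε (x ⟨2 * i, by omega⟩) (x ⟨2 * i + 1, by omega⟩)
    else x ⟨2 * i, by omega⟩ * x ⟨2 * i + 1, by omega⟩

/-- The affine polar graph `VO^ε_{2m}(2)`. -/
def VO (m : ℕ) (ε : ℤˣ) : SimpleGraph (Vec m) where
  Adj u v := u ≠ v ∧ quadForm m ε (u - v) = 0
  symm := ⟨fun u v h => ⟨h.1.symm, by
    have e : v - u = u - v := by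
      funext i
      simp only [Pi.sub_apply]
      generalize u i = a
      generalize v i = b
      revert a b
      decide
    rw [e]; exact h.2⟩⟩
  loopless := ⟨fun _ h => h.1 rfl⟩

instance (m : ℕ) (ε : ℤˣ) : DecidableRel (VO m ε).Adj := fun u v =>
  inferInstanceAs (Decidable (u ≠ v ∧ quadForm m ε (u - v) = 0))

/-- The vector `e₁ + e₂ = (1,1,0,…,0)`. -/
def e₁₂ (m : ℕ) : Vec m := fun i => if (i : ℕ) < 2 then 1 else 0

/-- The group `H₂` of automorphisms of `VO^ε_{2m}(2)` fixing both `0` and `e₁ + e₂`. -/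
def H₂ (m : ℕ) (ε : ℤˣ) : Subgroup (VO m ε ≃g VO m ε) where
  carrier := {g | g 0 = 0 ∧ g (e₁₂ m) = e₁₂ m}
  one_mem' := ⟨rfl, rfl⟩
  mul_mem' := fun {a _} ha hb =>
    ⟨(congrArg a hb.1).trans ha.1, (congrArg a hb.2).trans ha.2⟩
  inv_mem' := fun {a} ha => ⟨a.symm_apply_eq.2 ha.1.symm, a.symm_apply_eq.2 ha.2.symm⟩

/-- The set of orbits of `H₂` on the first subconstituent `Δ₁(0)`, the neighbours of `0`. -/
def orbitsH₂ (m : ℕ) (ε : ℤˣ) : Set (Set (Vec m)) :=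
  {O | ∃ x : Vec m, (VO m ε).Adj 0 x ∧ O = {y | ∃ g ∈ H₂ m ε, g x = y}}

end AffinePolar

/-! The inclusions of $T_{0,\omega}$ in $T_\omega$ and of $T_\omega$ in $\widetilde T_\omega$ hold
for every graph. Matrices in $T_{0,\omega}$ are the functions of the triple type of $(\omega,x,y)$,
and those in $\widetilde T_\omega$ are constant on stabilizer orbits of pairs. So everything in part
1 follows once automorphisms are transitive on vertex triples of each type (`IsTripleHomogeneous`).

For the affine polar graph, translations move the first vertex to $0$. The rest is a small case of
Witt's theorem, `exists_iso_fixing`: one involutive isometry, a transvection or an Eichler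
transformation, carries $y$ to $y'$ while fixing $x$.

The dimension is the number of realized triangle types. Of these, 7 involve equality and at most 8
do not; the all-singular type fails exactly when there is no totally singular plane, i.e. for
$(m,\varepsilon)=(2,-1)$. The orbits of $H_2$ are separated by the polar form with $e_1+e_2$, and
`exists_iso_fixing` shows that nothing else separates them. -/

namespace SimpleGraph

/-! ### Invariance under automorphisms -/

theorem card_commonNeighbors_map {V : Type*} [Fintype V] {G : SimpleGraph V}
    [DecidableRel G.Adj] (g : G ≃g G) (u v : V) :
    Fintype.card (G.commonNeighbors (g u) (g v)) = Fintype.card (G.commonNeighbors u v) := by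
  refine (Fintype.card_congr (g.toEquiv.subtypeEquiv fun x => ?_)).symm
  simp only [mem_commonNeighbors]
  exact (and_congr g.map_adj_iff g.map_adj_iff).symm

theorem mem_stabilizerCentralizer_iff {V : Type*} [Fintype V] [DecidableEq V]
    {G : SimpleGraph V} {ω : V} {M : Matrix V V ℂ} :
    M ∈ G.stabilizerCentralizer ω ↔
      ∀ g : G ≃g G, g ω = ω → ∀ x y, M (g x) (g y) = M x y := by
  have commute_iff (g : G ≃g G) :
      Equiv.Perm.permMatrix ℂ g.toEquiv * M = M * Equiv.Perm.permMatrix ℂ g.toEquiv ↔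
        ∀ x y, M (g x) (g y) = M x y := by
    rw [Equiv.Perm.permMatrix, PEquiv.toMatrix_toPEquiv_mul, PEquiv.mul_toMatrix_toPEquiv]
    constructor
    · intro h x y
      have : M (g x) (g y) = M x (g.symm (g y)) := congrFun (congrFun h x) (g y)
      rwa [g.symm_apply_apply] at this
    · intro h
      ext x y
      have := h x (g.symm y)
      rwa [g.apply_symm_apply] at this
  constructor
  · intro h g hg
    exact (commute_iff g).1 (h _ ⟨g, hg, rfl⟩)
  · rintro h _ ⟨g, hg, rfl⟩
    exact (commute_iff g).2 (h g hg)

/-! ### Triple types and triple homogeneity -/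

section relationType

variable {V : Type*} [DecidableEq V] (G : SimpleGraph V) [DecidableRel G.Adj]

/-- The relation between two vertices: `0` for equal, `1` for adjacent, `2` for distinct and
non-adjacent. -/
def relType (u v : V) : Fin 3 :=
  if u = v then 0 else if G.Adj u v then 1 else 2

theorem relType_eq_zero {u v : V} : G.relType u v = 0 ↔ u = v := by
  unfold relType
  split_ifs <;> simp_all

theorem relType_eq_one {u v : V} : G.relType u v = 1 ↔ G.Adj u v := by
  unfold relType
  split_ifs with h h' <;> simp_all

theorem relType_eq_two {u v : V} : G.relType u v = 2 ↔ u ≠ v ∧ ¬ G.Adj u v := by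
  unfold relType
  split_ifs with h h' <;> simp_all

theorem relType_map (g : G ≃g G) (u v : V) : G.relType (g u) (g v) = G.relType u v := by
  simp only [relType, g.map_adj_iff, g.injective.eq_iff]

/-- The relation types of a vertex pair `(x, y)` seen from the base vertex `ω`. -/
def tripleType (ω x y : V) : Fin 3 × Fin 3 × Fin 3 :=
  (G.relType ω x, G.relType x y, G.relType ω y)

theorem tripleType_map (g : G ≃g G) (ω x y : V) :
    G.tripleType (g ω) (g x) (g y) = G.tripleType ω x y := by
  simp only [tripleType, relType_map]

/-- Vertex triples with the same pairwise relations are equivalent under automorphisms. -/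
def IsTripleHomogeneous : Prop :=
  ∀ u v w u' v' w' : V, G.tripleType u v w = G.tripleType u' v' w' →
    ∃ g : G ≃g G, g u = u' ∧ g v = v' ∧ g w = w'

theorem schemeMatrix_apply (i : Fin 3) (u v : V) :
    G.schemeMatrix i u v = if G.relType u v = i then 1 else 0 := by
  fin_cases i
  · simp [schemeMatrix, Matrix.one_apply, relType_eq_zero]
  · simp [schemeMatrix, adjMatrix_apply, relType_eq_one]
  · simp [schemeMatrix, adjMatrix_apply, relType_eq_two]

/-- The matrix whose `(x, y)` entry is a given function of the triple type of `(x, y)`. -/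
noncomputable def ofTripleType (ω : V) :
    (Set.range (fun p : V × V => G.tripleType ω p.1 p.2) → ℂ) →ₗ[ℂ] Matrix V V ℂ where
  toFun c := Matrix.of fun x y => c ⟨G.tripleType ω x y, (x, y), rfl⟩
  map_add' _ _ := rfl
  map_smul' _ _ := rfl

theorem ofTripleType_apply (ω : V)
    (c : Set.range (fun p : V × V => G.tripleType ω p.1 p.2) → ℂ) (x y : V) :
    G.ofTripleType ω c x y = c ⟨G.tripleType ω x y, (x, y), rfl⟩ := rfl

/-- Coefficients are indexed by realized types only, so each one appears as an entry. This turns the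
dimension into a count of types. -/
theorem ofTripleType_injective (ω : V) : Function.Injective (G.ofTripleType ω) := by
  intro c d h
  funext ⟨_, ⟨x, y⟩, rfl⟩
  exact congrFun (congrFun h x) y

variable {G}

theorem IsTripleHomogeneous.exists_map_pair (hG : G.IsTripleHomogeneous) {u v u' v' : V}
    (h : G.relType u v = G.relType u' v') : ∃ g : G ≃g G, g u = u' ∧ g v = v' := by
  have h0 (x : V) : G.relType x x = 0 := G.relType_eq_zero.2 rfl
  obtain ⟨g, hu, hv, -⟩ := hG u v v u' v' v' (by simp only [tripleType, h, h0])
  exact ⟨g, hu, hv⟩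

theorem IsTripleHomogeneous.isVertexTransitive (hG : G.IsTripleHomogeneous) :
    G.IsVertexTransitive := by
  intro u v
  have h0 (x : V) : G.relType x x = 0 := G.relType_eq_zero.2 rfl
  obtain ⟨g, hu, -⟩ := hG.exists_map_pair ((h0 u).trans (h0 v).symm)
  exact ⟨g, hu⟩

end relationType

/-! ### Coincidence of the three spaces for triple-homogeneous graphs -/

section homogeneous

variable {V : Type*} [Fintype V] [DecidableEq V] {G : SimpleGraph V} [DecidableRel G.Adj]

theorem tripleProduct_apply (ω : V) (i j k : Fin 3) (x y : V) :
    (G.dualIdempotent ω i * G.schemeMatrix j * G.dualIdempotent ω k) x y =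
      if G.tripleType ω x y = (i, j, k) then 1 else 0 := by
  simp only [dualIdempotent, Matrix.mul_diagonal, Matrix.diagonal_mul, schemeMatrix_apply,
    tripleType, Prod.mk.injEq]
  split_ifs <;> simp_all

theorem tripleSpan_eq_range (ω : V) :
    G.tripleSpan ω = LinearMap.range (G.ofTripleType ω) := by
  apply le_antisymm
  · refine Submodule.span_le.2 ?_
    rintro _ ⟨i, j, k, rfl⟩
    -- For an unrealized type this function is zero, and so is the product.
    refine ⟨fun t => if t.1 = (i, j, k) then 1 else 0, ?_⟩
    ext x y
    rw [tripleProduct_apply]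
    rfl
  · rintro _ ⟨c, rfl⟩
    have key : G.ofTripleType ω c = ∑ t, c t •
        (G.dualIdempotent ω t.1.1 * G.schemeMatrix t.1.2.1 * G.dualIdempotent ω t.1.2.2) := by
      ext x y
      simp only [Matrix.sum_apply, Matrix.smul_apply, tripleProduct_apply]
      rw [Finset.sum_eq_single ⟨G.tripleType ω x y, (x, y), rfl⟩]
      · simp [ofTripleType_apply]
      · rintro ⟨t, ht⟩ - hne
        rw [if_neg, smul_zero]
        exact fun h => hne (Subtype.ext h.symm)
      · exact fun h => (h (Finset.mem_univ _)).elim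
    rw [key]
    exact Submodule.sum_mem _ fun t _ =>
      Submodule.smul_mem _ _ (Submodule.subset_span ⟨_, _, _, rfl⟩)

theorem finrank_tripleSpan (ω : V) : Module.finrank ℂ (G.tripleSpan ω) =
    (Set.range fun p : V × V => G.tripleType ω p.1 p.2).ncard := by
  rw [tripleSpan_eq_range, LinearMap.finrank_range_of_inj (G.ofTripleType_injective ω),
    Module.finrank_fintype_fun_eq_card, ← Nat.card_eq_fintype_card, Nat.card_coe_set_eq]

theorem tripleSpan_le_terwilligerAlgebra (ω : V) :
    G.tripleSpan ω ≤ Subalgebra.toSubmodule (G.terwilligerAlgebra ω) := by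
  refine Submodule.span_le.2 ?_
  rintro _ ⟨i, j, k, rfl⟩
  rw [SetLike.mem_coe, Subalgebra.mem_toSubmodule]
  exact mul_mem (mul_mem (Algebra.subset_adjoin (Or.inr ⟨i, rfl⟩))
    (Algebra.subset_adjoin (Or.inl ⟨j, rfl⟩))) (Algebra.subset_adjoin (Or.inr ⟨k, rfl⟩))

theorem terwilligerAlgebra_le_stabilizerCentralizer (ω : V) :
    G.terwilligerAlgebra ω ≤ G.stabilizerCentralizer ω := by
  refine Algebra.adjoin_le ?_
  rintro _ (⟨i, rfl⟩ | ⟨i, rfl⟩) <;> refine mem_stabilizerCentralizer_iff.2 fun g hg x y => ?_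
  · simp only [schemeMatrix_apply, relType_map]
  · have h : G.relType ω (g x) = G.relType ω x := by
      conv_lhs => rw [← hg, relType_map]
    simp only [dualIdempotent, Matrix.diagonal_apply, g.injective.eq_iff, schemeMatrix_apply, h]

theorem IsTripleHomogeneous.stabilizerCentralizer_le (hG : G.IsTripleHomogeneous) (ω : V) :
    Subalgebra.toSubmodule (G.stabilizerCentralizer ω) ≤ G.tripleSpan ω := by
  intro M hM
  rw [Subalgebra.mem_toSubmodule, mem_stabilizerCentralizer_iff] at hM
  rw [tripleSpan_eq_range]
  -- The coefficient is the entry of `M` at an arbitrary pair of type `t`; homogeneity makes the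
  -- choice irrelevant.
  refine ⟨fun t => M t.2.choose.1 t.2.choose.2, ?_⟩
  ext x y
  have ht : G.tripleType ω x y ∈ Set.range (fun p : V × V => G.tripleType ω p.1 p.2) :=
    ⟨(x, y), rfl⟩
  obtain ⟨g, hω, hx, hy⟩ := hG ω x y ω ht.choose.1 ht.choose.2 ht.choose_spec.symm
  change M ht.choose.1 ht.choose.2 = M x y
  rw [← hx, ← hy, hM g hω]

theorem IsTripleHomogeneous.tripleSpan_eq_stabilizerCentralizer (hG : G.IsTripleHomogeneous)
    (ω : V) : G.tripleSpan ω = Subalgebra.toSubmodule (G.stabilizerCentralizer ω) :=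
  le_antisymm ((tripleSpan_le_terwilligerAlgebra ω).trans
    (terwilligerAlgebra_le_stabilizerCentralizer ω)) (hG.stabilizerCentralizer_le ω)

theorem IsTripleHomogeneous.exists_card_commonNeighbors (hG : G.IsTripleHomogeneous)
    (i : Fin 3) :
    ∃ n, ∀ u v, G.relType u v = i → Fintype.card (G.commonNeighbors u v) = n := by
  by_cases h : ∃ u v, G.relType u v = i
  · obtain ⟨u, v, huv⟩ := h
    refine ⟨Fintype.card (G.commonNeighbors u v), fun u' v' h' => ?_⟩
    obtain ⟨g, rfl, rfl⟩ := hG.exists_map_pair (huv.trans h'.symm)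
    exact card_commonNeighbors_map g u v
  · push Not at h
    exact ⟨0, fun u v huv => (h u v huv).elim⟩

theorem IsTripleHomogeneous.isStronglyRegular (hG : G.IsTripleHomogeneous) :
    G.IsStronglyRegular := by
  -- The common neighbours of a vertex with itself are its neighbours, so type `0` gives the degree.
  obtain ⟨k, hk⟩ := hG.exists_card_commonNeighbors 0
  obtain ⟨l, hl⟩ := hG.exists_card_commonNeighbors 1
  obtain ⟨μ, hμ⟩ := hG.exists_card_commonNeighbors 2
  refine ⟨_, k, l, μ, rfl, fun u => ?_, fun u v h => hl u v (G.relType_eq_one.2 h),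
    fun u v huv h => hμ u v (G.relType_eq_two.2 ⟨huv, h⟩)⟩
  rw [← hk u u (G.relType_eq_zero.2 rfl), ← card_neighborSet_eq_degree]
  exact Fintype.card_congr (Equiv.setCongr (by simp [commonNeighbors]))

theorem IsTripleHomogeneous.isTriplyTransitive (hG : G.IsTripleHomogeneous) :
    G.IsTriplyTransitive := by
  refine ⟨hG.isStronglyRegular, hG.isVertexTransitive, fun ω => ?_⟩
  have h := hG.stabilizerCentralizer_le ω
  have h₀ := G.tripleSpan_le_terwilligerAlgebra ω
  have h₁ := G.terwilligerAlgebra_le_stabilizerCentralizer ω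
  exact ⟨le_antisymm h₀ (le_trans (Subalgebra.toSubmodule.monotone h₁) h),
    le_antisymm h₁ (Subalgebra.toSubmodule.le_iff_le.1 (h.trans h₀))⟩

end homogeneous

end SimpleGraph
-- The polar form and its nondegeneracy
namespace AffinePolar

variable {m : ℕ} {ε : ℤˣ}

/-- The first coordinate of the `i`-th pair. -/
def lo (i : Fin m) : Fin (2 * m) := ⟨2 * i, by omega⟩

/-- The second coordinate of the `i`-th pair. -/
def hi (i : Fin m) : Fin (2 * m) := ⟨2 * i + 1, by omega⟩

theorem lo_injective : Function.Injective (lo (m := m)) := fun i j h => by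
  simp only [lo, Fin.mk.injEq] at h
  exact Fin.ext (by omega)

theorem hi_injective : Function.Injective (hi (m := m)) := fun i j h => by
  simp only [hi, Fin.mk.injEq] at h
  exact Fin.ext (by omega)

theorem lo_ne_hi (i j : Fin m) : lo i ≠ hi j := fun h => by
  simp only [lo, hi, Fin.mk.injEq] at h
  omega

theorem exists_eq_lo_or_hi (j : Fin (2 * m)) : ∃ i : Fin m, j = lo i ∨ j = hi i := by
  refine ⟨⟨j / 2, by omega⟩, ?_⟩
  simp only [lo, hi, Fin.ext_iff]
  omega

/-- The polar form of `quadForm`. -/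
def polarForm (m : ℕ) : Vec m →ₗ[ZMod 2] Vec m →ₗ[ZMod 2] ZMod 2 :=
  LinearMap.mk₂ (ZMod 2) (fun x y => ∑ i : Fin m, (x (lo i) * y (hi i) + x (hi i) * y (lo i)))
    (fun x x' y => by simp only [Pi.add_apply, ← Finset.sum_add_distrib]; congr! 1; ring)
    (fun c x y => by
      simp only [Pi.smul_apply, smul_eq_mul, Finset.mul_sum]; congr! 1; ring)
    (fun x y y' => by simp only [Pi.add_apply, ← Finset.sum_add_distrib]; congr! 1; ring)
    (fun c x y => by
      simp only [Pi.smul_apply, smul_eq_mul, Finset.mul_sum]; congr! 1; ring)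

theorem polarForm_apply (x y : Vec m) :
    polarForm m x y = ∑ i : Fin m, (x (lo i) * y (hi i) + x (hi i) * y (lo i)) := rfl

theorem polarForm_comm (x y : Vec m) : polarForm m x y = polarForm m y x := by
  simp only [polarForm_apply]
  congr! 1
  ring

theorem polarForm_self (x : Vec m) : polarForm m x x = 0 := by
  rw [polarForm_apply]
  refine Finset.sum_eq_zero fun i _ => ?_
  rw [mul_comm]
  exact CharTwo.add_self_eq_zero _

/-- Squares are additive in characteristic 2, so the polar form does not depend on `ε`. -/
theorem quadForm_add (x y : Vec m) :
    quadForm m ε (x + y) = quadForm m ε x + quadForm m ε y + polarForm m x y := by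
  simp only [quadForm, polarForm_apply, ← Finset.sum_add_distrib]
  refine Finset.sum_congr rfl fun i _ => ?_
  change (if _ then lastForm ε (x (lo i) + y (lo i)) (x (hi i) + y (hi i)) else
      (x (lo i) + y (lo i)) * (x (hi i) + y (hi i))) =
    (if _ then lastForm ε (x (lo i)) (x (hi i)) else x (lo i) * x (hi i)) +
    (if _ then lastForm ε (y (lo i)) (y (hi i)) else y (lo i) * y (hi i)) + _
  unfold lastForm
  generalize x (lo i) = a
  generalize x (hi i) = b
  generalize y (lo i) = c
  generalize y (hi i) = d
  split_ifs <;> revert a b c d <;> decide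

@[simp]
theorem quadForm_zero : quadForm m ε 0 = 0 := by
  have h := quadForm_add (ε := ε) (0 : Vec m) 0
  simpa using h

theorem polarForm_single_hi (i : Fin m) (y : Vec m) :
    polarForm m (Pi.single (hi i) 1) y = y (lo i) := by
  rw [polarForm_apply, Finset.sum_eq_single i]
  · simp [lo_ne_hi]
  · intro j _ hj
    simp [lo_ne_hi, hi_injective.eq_iff, hj]
  · exact fun h => (h (Finset.mem_univ _)).elim

theorem polarForm_single_lo (i : Fin m) (y : Vec m) :
    polarForm m (Pi.single (lo i) 1) y = y (hi i) := by
  rw [polarForm_apply, Finset.sum_eq_single i]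
  · simp [(lo_ne_hi _ _).symm]
  · intro j _ hj
    simp [(lo_ne_hi _ _).symm, lo_injective.eq_iff, hj]
  · exact fun h => (h (Finset.mem_univ _)).elim

/-- Pairing with unit vectors reads off the coordinates, so the form is nondegenerate; equal
dimensions then give surjectivity onto the dual. -/
theorem exists_polarForm_eq (f : Module.Dual (ZMod 2) (Vec m)) :
    ∃ v, ∀ x, polarForm m x v = f x := by
  have hinj : Function.Injective (polarForm m) := by
    refine (injective_iff_map_eq_zero _).2 fun v hv => funext fun j => ?_
    have hv' (x : Vec m) : polarForm m x v = 0 := by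
      rw [polarForm_comm, hv, LinearMap.zero_apply]
    obtain ⟨i, rfl | rfl⟩ := exists_eq_lo_or_hi j
    · rw [← polarForm_single_hi i v, hv', Pi.zero_apply]
    · rw [← polarForm_single_lo i v, hv', Pi.zero_apply]
  obtain ⟨v, hv⟩ := (LinearMap.injective_iff_surjective_of_finrank_eq_finrank
    (Subspace.dual_finrank_eq (K := ZMod 2) (V := Vec m)).symm).1 hinj f
  exact ⟨v, fun x => by rw [polarForm_comm, hv]⟩

theorem eq_zero_or_one (c : ZMod 2) : c = 0 ∨ c = 1 := by
  revert c; decide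

/-- Over $\mathbb F_2$ the four excluded vectors are the whole span of `x` and `d`. -/
theorem exists_polarForm_separating {x d y : Vec m} (h0 : y ≠ 0) (hx : y ≠ x) (hd : y ≠ d)
    (hxd : y ≠ x + d) :
    ∃ v, polarForm m x v = 0 ∧ polarForm m d v = 0 ∧ polarForm m y v = 1 := by
  have hy : y ∉ Submodule.span (ZMod 2) {x, d} := by
    rw [Submodule.mem_span_pair]
    rintro ⟨a, b, rfl⟩
    rcases eq_zero_or_one a with rfl | rfl <;> rcases eq_zero_or_one b with rfl | rfl <;> simp_all
  obtain ⟨f, hfy, hf⟩ := Submodule.exists_le_ker_of_notMem hy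
  obtain ⟨v, hv⟩ := exists_polarForm_eq f
  refine ⟨v, ?_, ?_, ?_⟩
  · rw [hv]; exact hf (Submodule.subset_span (by simp))
  · rw [hv]; exact hf (Submodule.subset_span (by simp))
  · rw [hv]; exact (eq_zero_or_one _).resolve_left hfy

theorem sub_eq_add_vec (x y : Vec m) : x - y = x + y := by
  funext i
  exact CharTwo.sub_eq_add _ _

theorem add_self_vec (x : Vec m) : x + x = 0 := by
  funext i
  exact CharTwo.add_self_eq_zero _

/-! ### Isometries and triple homogeneity of the affine polar graph -/

theorem VO_adj {u v : Vec m} : (VO m ε).Adj u v ↔ u ≠ v ∧ quadForm m ε (u + v) = 0 := by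
  rw [← sub_eq_add_vec]
  rfl

/-- An involutive linear isometry, as a graph automorphism. -/
def isoOfInvolutive (f : Vec m →ₗ[ZMod 2] Vec m) (hf : Function.Involutive f)
    (hQ : ∀ x, quadForm m ε (f x) = quadForm m ε x) : VO m ε ≃g VO m ε where
  toEquiv := hf.toPerm
  map_rel_iff' := by
    intro a b
    simp only [VO_adj, Function.Involutive.coe_toPerm, hf.injective.ne_iff, ← map_add, hQ]

/-- The orthogonal transvection with centre the non-singular vector `d`. -/
theorem exists_transvection {d : Vec m} (hd : quadForm m ε d = 1) :
    ∃ g : VO m ε ≃g VO m ε, ∀ t, g t = t + polarForm m t d • d := by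
  refine ⟨isoOfInvolutive (LinearMap.id + ((polarForm m).flip d).smulRight d) ?_ ?_, fun t => rfl⟩
  · intro t
    simp only [LinearMap.add_apply, LinearMap.id_apply, LinearMap.smulRight_apply,
      LinearMap.flip_apply, map_add, map_smul, polarForm_self,
      zero_smul, add_zero]
    rw [add_assoc, add_self_vec, add_zero]
  · intro t
    simp only [LinearMap.add_apply, LinearMap.id_apply, LinearMap.smulRight_apply,
      LinearMap.flip_apply]
    rcases eq_zero_or_one (polarForm m t d) with h | h
    · rw [h, zero_smul, add_zero]
    · rw [h, one_smul, quadForm_add, h, hd, add_assoc, CharTwo.add_self_eq_zero, add_zero]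

/-- The Eichler transformation attached to a singular vector `d` and a vector `v ⟂ d`. -/
theorem exists_eichler {d v : Vec m} (hd : quadForm m ε d = 0) (hdv : polarForm m d v = 0) :
    ∃ g : VO m ε ≃g VO m ε, ∀ t, g t = t + (polarForm m t d • v +
      (polarForm m t v + quadForm m ε v * polarForm m t d) • d) := by
  have hvd : polarForm m v d = 0 := by rw [polarForm_comm, hdv]
  refine ⟨isoOfInvolutive (LinearMap.id + (((polarForm m).flip d).smulRight v +
    ((polarForm m).flip v + quadForm m ε v • (polarForm m).flip d).smulRight d)) ?_ ?_,
    fun t => rfl⟩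
  -- The map preserves the pairings with `d` and `v`, so a second application adds the same
  -- correction, which cancels.
  · intro t
    simp only [LinearMap.add_apply, LinearMap.id_apply, LinearMap.smulRight_apply,
      LinearMap.flip_apply, map_add, map_smul, LinearMap.smul_apply, polarForm_self, smul_zero,
      add_zero, hdv, hvd, zero_smul]
    rw [add_assoc, add_self_vec, add_zero]
  · intro t
    simp only [LinearMap.add_apply, LinearMap.id_apply, LinearMap.smulRight_apply,
      LinearMap.flip_apply, LinearMap.smul_apply, smul_eq_mul]
    rcases eq_zero_or_one (polarForm m t d) with h | h <;>
    rcases eq_zero_or_one (polarForm m t v) with h' | h' <;>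
    rcases eq_zero_or_one (quadForm m ε v) with h'' | h'' <;>
    simp [h, h', h'', quadForm_add, hd, hvd, add_assoc, CharTwo.add_self_eq_zero]

/-- With $d=y+y'$, the hypotheses say $d\perp x$ and $Q(d)=B(y,d)$. If this value is 1, the
transvection along $d$ works. If it is 0, an Eichler transformation does, with $v\perp x,d$ and
$B(y,v)=1$. -/
theorem exists_iso_fixing {x y y' : Vec m} (hQ : quadForm m ε y = quadForm m ε y')
    (hB : polarForm m x y = polarForm m x y') (hy : y ≠ 0) (hy' : y' ≠ 0) (hyx : y ≠ x)
    (hyx' : y' ≠ x) : ∃ g : VO m ε ≃g VO m ε, g 0 = 0 ∧ g x = x ∧ g y = y' := by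
  by_cases hne : y = y'
  · exact ⟨RelIso.refl _, rfl, rfl, hne⟩
  obtain ⟨d, rfl⟩ : ∃ d, y' = y + d := ⟨y + y', by rw [← add_assoc, add_self_vec, zero_add]⟩
  have hxd : polarForm m x d = 0 := by simpa using hB
  have hQd : quadForm m ε d = polarForm m y d := by
    rw [quadForm_add, add_assoc] at hQ
    exact CharTwo.add_eq_zero.1 (by simpa using hQ)
  rcases eq_zero_or_one (polarForm m y d) with h | h
  · obtain ⟨v, hxv, hdv, hyv⟩ := exists_polarForm_separating (x := x) (d := d) hy hyx
      (fun e => hy' (by rw [← e, add_self_vec]))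
      (fun e => hyx' (by rw [e, add_assoc, add_self_vec, add_zero]))
    obtain ⟨g, hg⟩ := exists_eichler (hQd.trans h) hdv
    exact ⟨g, by simp [hg], by simp [hg, hxd, hxv], by simp [hg, h, hyv]⟩
  · obtain ⟨g, hg⟩ := exists_transvection (hQd.trans h)
    exact ⟨g, by simp [hg], by simp [hg, hxd], by simp [hg, h]⟩

theorem relType_zero_eq_iff {x y : Vec m} :
    (VO m ε).relType 0 x = (VO m ε).relType 0 y ↔
      ((x = 0 ↔ y = 0) ∧ quadForm m ε x = quadForm m ε y) := by
  simp only [SimpleGraph.relType, VO_adj, zero_add, eq_comm (a := (0 : Vec m)), ne_eq]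
  by_cases hx : x = 0 <;> by_cases hy : y = 0 <;>
  rcases eq_zero_or_one (quadForm m ε x) with h | h <;>
  rcases eq_zero_or_one (quadForm m ε y) with h' | h' <;> simp_all

/-- Translation, as a graph automorphism. -/
def translation (ε : ℤˣ) (a : Vec m) : VO m ε ≃g VO m ε where
  toEquiv := Equiv.addRight a
  map_rel_iff' := by
    intro u v
    simp only [VO_adj, Equiv.coe_addRight, ne_eq, add_left_inj]
    rw [add_add_add_comm, add_self_vec, add_zero]

@[simp]
theorem translation_apply (a x : Vec m) : translation ε a x = x + a := rfl

theorem relType_eq_zero_add (x y : Vec m) :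
    (VO m ε).relType x y = (VO m ε).relType 0 (x + y) := by
  rw [← SimpleGraph.relType_map _ (translation ε x), translation_apply, translation_apply,
    add_self_vec, add_comm y]

theorem exists_iso_of_tripleType_zero {x y x' y' : Vec m}
    (h : (VO m ε).tripleType 0 x y = (VO m ε).tripleType 0 x' y') :
    ∃ g : VO m ε ≃g VO m ε, g 0 = 0 ∧ g x = x' ∧ g y = y' := by
  obtain ⟨g, hg0, hgx⟩ : ∃ g : VO m ε ≃g VO m ε, g 0 = 0 ∧ g x = x' := by
    simp only [SimpleGraph.tripleType, Prod.mk.injEq] at h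
    obtain ⟨h0, hQ⟩ := relType_zero_eq_iff.1 h.1
    by_cases hx : x = 0
    · exact ⟨RelIso.refl _, rfl, hx.trans (h0.1 hx).symm⟩
    -- With fixed vector `0` the condition on the polar form is vacuous.
    · obtain ⟨g, hg, -, hgx⟩ := exists_iso_fixing (x := 0) hQ (by simp) hx (mt h0.2 hx) hx
        (mt h0.2 hx)
      exact ⟨g, hg, hgx⟩
  rw [← SimpleGraph.tripleType_map _ g 0, hg0, hgx] at h
  simp only [SimpleGraph.tripleType, Prod.mk.injEq, true_and] at h
  rw [relType_eq_zero_add x' _, relType_eq_zero_add x' _] at h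
  obtain ⟨h1, h2⟩ := h
  obtain ⟨h0, hQ⟩ := relType_zero_eq_iff.1 h2
  obtain ⟨h0', hQ'⟩ := relType_zero_eq_iff.1 h1
  have add_eq_zero_iff_eq (u v : Vec m) : u + v = 0 ↔ v = u := by
    rw [← sub_eq_add_vec, sub_eq_zero, eq_comm]
  rw [add_eq_zero_iff_eq, add_eq_zero_iff_eq] at h0'
  rw [quadForm_add, quadForm_add, hQ, add_right_inj] at hQ'
  by_cases hy : g y = 0
  · exact ⟨g, hg0, hgx, hy.trans (h0.1 hy).symm⟩
  by_cases hyx : g y = x'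
  · exact ⟨g, hg0, hgx, hyx.trans (h0'.1 hyx).symm⟩
  obtain ⟨g', h1, h2, h3⟩ := exists_iso_fixing hQ hQ' hy (mt h0.2 hy) hyx (mt h0'.2 hyx)
  exact ⟨g.trans g', by simp [hg0, h1], by simp [hgx, h2], by simp [h3]⟩

theorem VO_isTripleHomogeneous (m : ℕ) (ε : ℤˣ) : (VO m ε).IsTripleHomogeneous := by
  intro u v w u' v' w' h
  rw [← SimpleGraph.tripleType_map _ (translation ε u) u,
    ← SimpleGraph.tripleType_map _ (translation ε u') u'] at h
  simp only [translation_apply, add_self_vec] at h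
  obtain ⟨g, h0, hv, hw⟩ := exists_iso_of_tripleType_zero h
  refine ⟨((translation ε u).trans g).trans (translation ε u'), ?_, ?_, ?_⟩ <;>
    simp [add_self_vec, add_assoc, h0, hv, hw]

end AffinePolar
-- Realized triangle types and the dimension
namespace AffinePolar

variable {m : ℕ} {ε : ℤˣ}

theorem quadForm_eq_sum (x : Vec m) : quadForm m ε x = ∑ i : Fin m,
    if (i : ℕ) + 1 = m then lastForm ε (x (lo i)) (x (hi i)) else x (lo i) * x (hi i) := rfl

theorem lastForm_zero : lastForm ε 0 0 = 0 := by
  unfold lastForm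
  split_ifs <;> decide

theorem quadForm_single_lo (i : Fin m) : quadForm m ε (Pi.single (lo i) 1) =
    if (i : ℕ) + 1 = m ∧ ε ≠ 1 then 1 else 0 := by
  rw [quadForm_eq_sum, Finset.sum_eq_single i]
  · by_cases h : (i : ℕ) + 1 = m <;> by_cases h' : ε = 1 <;>
      simp [h, h', lastForm, (lo_ne_hi _ _).symm]
  · intro j _ hj
    simp [(lo_ne_hi _ _).symm, lo_injective.eq_iff, hj, lastForm_zero]
  · exact fun h => (h (Finset.mem_univ _)).elim

theorem quadForm_single_hi (i : Fin m) : quadForm m ε (Pi.single (hi i) 1) =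
    if (i : ℕ) + 1 = m ∧ ε ≠ 1 then 1 else 0 := by
  rw [quadForm_eq_sum, Finset.sum_eq_single i]
  · by_cases h : (i : ℕ) + 1 = m <;> by_cases h' : ε = 1 <;>
      simp [h, h', lastForm, lo_ne_hi]
  · intro j _ hj
    simp [lo_ne_hi, hi_injective.eq_iff, hj, lastForm_zero]
  · exact fun h => (h (Finset.mem_univ _)).elim

theorem single_ne_zero_vec (j : Fin (2 * m)) : (Pi.single j 1 : Vec m) ≠ 0 :=
  Pi.single_ne_zero_iff.2 one_ne_zero

theorem relType_zero_eq_one {x : Vec m} :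
    (VO m ε).relType 0 x = 1 ↔ x ≠ 0 ∧ quadForm m ε x = 0 := by
  rw [SimpleGraph.relType_eq_one, VO_adj, zero_add, ne_comm]

theorem relType_zero_eq_two {x : Vec m} :
    (VO m ε).relType 0 x = 2 ↔ quadForm m ε x = 1 := by
  rw [SimpleGraph.relType_eq_two, VO_adj, zero_add, ne_comm]
  rcases eq_zero_or_one (quadForm m ε x) with h | h
  · simp [h]
  · have : x ≠ 0 := by rintro rfl; simp at h
    simp [h, this]

/-- There is a triangle `0, x, y` whose sides have the relation types `i, j, k`. -/
def Realized (m : ℕ) (ε : ℤˣ) (i j k : Fin 3) : Prop :=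
  ∃ x y : Vec m, (VO m ε).relType 0 x = i ∧ (VO m ε).relType 0 (x + y) = j ∧
    (VO m ε).relType 0 y = k

theorem Realized.reverse {i j k : Fin 3} : Realized m ε i j k → Realized m ε k j i := by
  rintro ⟨x, y, hx, hxy, hy⟩
  exact ⟨y, x, hy, by rwa [add_comm], hx⟩

/-- Together with `Realized.reverse` this gives all permutations of the sides. -/
theorem Realized.swap {i j k : Fin 3} : Realized m ε i j k → Realized m ε i k j := by
  rintro ⟨x, y, hx, hxy, hy⟩
  exact ⟨x, x + y, hx, by rwa [← add_assoc, add_self_vec, zero_add], hxy⟩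

theorem mem_range_tripleType {ω : Vec m} {i j k : Fin 3} :
    (i, j, k) ∈ Set.range (fun p : Vec m × Vec m => (VO m ε).tripleType ω p.1 p.2) ↔
      Realized m ε i j k := by
  have key (x y : Vec m) : (VO m ε).tripleType ω x y = ((VO m ε).relType 0 (x + ω),
      (VO m ε).relType 0 ((x + ω) + (y + ω)), (VO m ε).relType 0 (y + ω)) := by
    rw [SimpleGraph.tripleType, relType_eq_zero_add, relType_eq_zero_add x,
      relType_eq_zero_add ω y, add_add_add_comm, add_self_vec, add_zero, add_comm ω x,
      add_comm ω y]
  constructor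
  · rintro ⟨⟨x, y⟩, h⟩
    simp only [key, Prod.mk.injEq] at h
    exact ⟨_, _, h.1, h.2.1, h.2.2⟩
  · rintro ⟨x, y, rfl, rfl, rfl⟩
    refine ⟨(x + ω, y + ω), ?_⟩
    simp only [key, add_assoc, add_self_vec, add_zero]

theorem Realized.eq_of_zero {j k : Fin 3} : Realized m ε 0 j k → j = k := by
  rintro ⟨x, y, hx, rfl, rfl⟩
  obtain rfl := (SimpleGraph.relType_eq_zero _).1 hx
  rw [zero_add]

theorem realized_zero (hm : 2 ≤ m) (i : Fin 3) : Realized m ε 0 i i := by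
  obtain ⟨x, hx⟩ : ∃ x, (VO m ε).relType 0 x = i := by
    have h0 : ¬ 0 + 1 = m := by omega
    let o : Fin m := ⟨0, by omega⟩
    fin_cases i
    · exact ⟨0, (SimpleGraph.relType_eq_zero _).2 rfl⟩
    · exact ⟨Pi.single (lo o) 1, relType_zero_eq_one.2 ⟨single_ne_zero_vec _, by
        simp [quadForm_single_lo, o, h0]⟩⟩
    · exact ⟨Pi.single (lo o) 1 + Pi.single (hi o) 1, relType_zero_eq_two.2 (by
        simp [quadForm_add, quadForm_single_lo, quadForm_single_hi, polarForm_single_lo, o, h0])⟩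
  exact ⟨0, x, (SimpleGraph.relType_eq_zero _).2 rfl, by rwa [zero_add], hx⟩

theorem realized_one_one_two (hm : 2 ≤ m) : Realized m ε 1 1 2 := by
  have h0 : ¬ 0 + 1 = m := by omega
  let o : Fin m := ⟨0, by omega⟩
  refine Realized.swap ⟨Pi.single (lo o) 1, Pi.single (hi o) 1, relType_zero_eq_one.2
    ⟨single_ne_zero_vec _, ?_⟩, relType_zero_eq_two.2 ?_, relType_zero_eq_one.2
    ⟨single_ne_zero_vec _, ?_⟩⟩ <;>
  simp [quadForm_add, quadForm_single_lo, quadForm_single_hi, polarForm_single_lo, o, h0]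

/-- Both binary forms take the value 1 at $(1,1)$, so the last pair needs no separate treatment. -/
theorem quadForm_lo_add_hi (i : Fin m) :
    quadForm m ε (Pi.single (lo i) 1 + Pi.single (hi i) 1) = 1 := by
  rw [quadForm_add, quadForm_single_lo, quadForm_single_hi, polarForm_single_lo, Pi.single_eq_same,
    CharTwo.add_self_eq_zero, zero_add]

theorem polarForm_lo_add_hi {i j : Fin m} (hij : i ≠ j) :
    polarForm m (Pi.single (lo i) 1 + Pi.single (hi i) 1)
      (Pi.single (lo j) 1 + Pi.single (hi j) 1) = 0 := by
  simp [polarForm_single_lo, polarForm_single_hi, lo_ne_hi, (lo_ne_hi _ _).symm,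
    lo_injective.eq_iff, hi_injective.eq_iff, hij]

theorem realized_one_two_two (hm : 2 ≤ m) : Realized m ε 1 2 2 := by
  let o : Fin m := ⟨0, by omega⟩
  let l : Fin m := ⟨1, by omega⟩
  have hol : o ≠ l := by simp [o, l, Fin.ext_iff]
  refine Realized.reverse (Realized.swap ⟨Pi.single (lo o) 1 + Pi.single (hi o) 1,
    Pi.single (lo l) 1 + Pi.single (hi l) 1, relType_zero_eq_two.2 (quadForm_lo_add_hi _),
    relType_zero_eq_one.2 ⟨fun h => ?_, ?_⟩, relType_zero_eq_two.2 (quadForm_lo_add_hi _)⟩)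
  · have := congrFun h (lo o)
    simp [lo_ne_hi, lo_injective.eq_iff, hol] at this
  · rw [quadForm_add, quadForm_lo_add_hi, quadForm_lo_add_hi, polarForm_lo_add_hi hol]
    rfl

theorem realized_two_two_two (hm : 2 ≤ m) : Realized m ε 2 2 2 := by
  have h0 : ¬ 0 + 1 = m := by omega
  let o : Fin m := ⟨0, by omega⟩
  let l : Fin m := ⟨1, by omega⟩
  have hol : o ≠ l := by simp [o, l, Fin.ext_iff]
  have hQ := quadForm_lo_add_hi (ε := ε) l
  -- The triangle is $x=e_1+e_2$, $y=e_1+e_3+e_4$, with $x+y=e_2+e_3+e_4$.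
  refine ⟨Pi.single (lo o) 1 + Pi.single (hi o) 1,
    Pi.single (lo o) 1 + (Pi.single (lo l) 1 + Pi.single (hi l) 1),
    relType_zero_eq_two.2 (quadForm_lo_add_hi _), relType_zero_eq_two.2 ?_,
    relType_zero_eq_two.2 ?_⟩
  · rw [quadForm_add, quadForm_lo_add_hi, map_add, polarForm_lo_add_hi hol, quadForm_add, hQ]
    simp [quadForm_single_lo, polarForm_single_lo, polarForm_single_hi,
      (lo_ne_hi _ _).symm, hi_injective.eq_iff, o, l, h0]
    decide
  · rw [quadForm_add, hQ]
    simp [quadForm_single_lo, polarForm_single_lo, (lo_ne_hi _ _).symm,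
      hi_injective.eq_iff, o, l, h0]

/-- The vectors $e_1,e_3$ span a totally singular plane; $e_3$ is singular unless its pair carries
the elliptic form. -/
theorem realized_one_one_one (hm : 2 ≤ m) (h : ¬ (m = 2 ∧ ε = -1)) : Realized m ε 1 1 1 := by
  have h0 : ¬ 0 + 1 = m := by omega
  let o : Fin m := ⟨0, by omega⟩
  let l : Fin m := ⟨1, by omega⟩
  have hol : o ≠ l := by simp [o, l, Fin.ext_iff]
  have hl : quadForm m ε (Pi.single (lo l) 1) = 0 := by
    rw [quadForm_single_lo, if_neg]
    rintro ⟨hm', hε⟩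
    exact h ⟨hm'.symm, (Int.units_eq_one_or ε).resolve_left hε⟩
  refine ⟨Pi.single (lo o) 1, Pi.single (lo l) 1, relType_zero_eq_one.2
    ⟨single_ne_zero_vec _, ?_⟩, relType_zero_eq_one.2 ⟨fun h => ?_, ?_⟩, relType_zero_eq_one.2
    ⟨single_ne_zero_vec _, hl⟩⟩
  · simp [quadForm_single_lo, o, h0]
  · have := congrFun h (lo o)
    simp [lo_injective.eq_iff, hol] at this
  · rw [quadForm_add, hl]
    simp [quadForm_single_lo, polarForm_single_lo, (lo_ne_hi _ _).symm, o, h0]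

theorem no_totally_singular_line : ∀ a b c d a' b' c' d' : ZMod 2,
    a * b + (c ^ 2 + c * d + d ^ 2) = 0 → a' * b' + (c' ^ 2 + c' * d' + d' ^ 2) = 0 →
    a * b' + b * a' + (c * d' + d * c') = 0 →
    (a = 0 ∧ b = 0 ∧ c = 0 ∧ d = 0) ∨ (a' = 0 ∧ b' = 0 ∧ c' = 0 ∧ d' = 0) ∨
    (a + a' = 0 ∧ b + b' = 0 ∧ c + c' = 0 ∧ d + d' = 0) := by
  decide

theorem not_realized_one_one_one : ¬ Realized 2 (-1) 1 1 1 := by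
  rintro ⟨x, y, hx, hxy, hy⟩
  rw [relType_zero_eq_one] at hx hxy hy
  have hB : polarForm 2 x y = 0 := by
    have := hxy.2
    rwa [quadForm_add, hx.2, hy.2, zero_add, zero_add] at this
  have hQ (z : Vec 2) : quadForm 2 (-1) z = z 0 * z 1 + (z 2 ^ 2 + z 2 * z 3 + z 3 ^ 2) := by
    rw [quadForm_eq_sum, Fin.sum_univ_two, if_neg (by simp), if_pos (by simp), lastForm,
      if_neg (by decide)]
    rfl
  have h0 (z : Vec 2) (h : z 0 = 0 ∧ z 1 = 0 ∧ z 2 = 0 ∧ z 3 = 0) : z = 0 := by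
    funext i
    fin_cases i
    exacts [h.1, h.2.1, h.2.2.1, h.2.2.2]
  rw [polarForm_apply, Fin.sum_univ_two] at hB
  rcases no_totally_singular_line _ _ _ _ _ _ _ _ ((hQ x).symm.trans hx.2)
    ((hQ y).symm.trans hy.2) hB with h | h | h
  · exact hx.1 (h0 x h)
  · exact hy.1 (h0 y h)
  · exact hxy.1 (h0 _ h)

theorem realized_iff (hm : 2 ≤ m) (i j k : Fin 3) : Realized m ε i j k ↔
    ((i = 0 → j = k) ∧ (j = 0 → i = k) ∧ (k = 0 → i = j)) ∧
      (m = 2 ∧ ε = -1 → ¬ (i = 1 ∧ j = 1 ∧ k = 1)) := by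
  constructor
  · intro h
    refine ⟨⟨?_, ?_, ?_⟩, ?_⟩
    · rintro rfl
      exact h.eq_of_zero
    · rintro rfl
      exact h.swap.reverse.eq_of_zero.symm
    · rintro rfl
      exact h.reverse.eq_of_zero.symm
    · rintro ⟨rfl, rfl⟩ ⟨rfl, rfl, rfl⟩
      exact not_realized_one_one_one h
  · rintro ⟨⟨hi, hj, hk⟩, h⟩
    by_cases i0 : i = 0
    · obtain rfl := hi i0
      exact i0 ▸ realized_zero hm j
    by_cases j0 : j = 0
    · obtain rfl := hj j0
      exact j0 ▸ (realized_zero hm i).swap.reverse.swap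
    by_cases k0 : k = 0
    · obtain rfl := hk k0
      exact k0 ▸ (realized_zero hm i).reverse
    have h₁ := realized_one_one_two (ε := ε) hm
    have h₂ := realized_one_two_two (ε := ε) hm
    have h₃ := realized_two_two_two (ε := ε) hm
    have h₄ := realized_one_one_one (ε := ε) hm
    fin_cases i <;> fin_cases j <;> fin_cases k <;>
      first
      | exact (i0 rfl).elim
      | exact (j0 rfl).elim
      | exact (k0 rfl).elim
      | exact h₁
      | exact h₁.swap
      | exact h₁.swap.reverse
      | exact h₁.reverse
      | exact h₂
      | exact h₂.swap
      | exact h₂.reverse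
      | exact h₂.reverse.swap
      | exact h₃
      | exact h₄ fun e => h e ⟨rfl, rfl, rfl⟩

theorem ncard_range_tripleType (hm : 2 ≤ m) (ω : Vec m) :
    (Set.range fun p : Vec m × Vec m => (VO m ε).tripleType ω p.1 p.2).ncard =
      if m = 2 ∧ ε = -1 then 14 else 15 := by
  have h : (Set.range fun p : Vec m × Vec m => (VO m ε).tripleType ω p.1 p.2) =
      ↑(Finset.univ.filter fun t : Fin 3 × Fin 3 × Fin 3 =>
        ((t.1 = 0 → t.2.1 = t.2.2) ∧ (t.2.1 = 0 → t.1 = t.2.2) ∧ (t.2.2 = 0 → t.1 = t.2.1)) ∧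
        (m = 2 ∧ ε = -1 → ¬ (t.1 = 1 ∧ t.2.1 = 1 ∧ t.2.2 = 1))) := by
    ext ⟨i, j, k⟩
    rw [mem_range_tripleType, realized_iff hm]
    simp
  rw [h, Set.ncard_coe_finset]
  by_cases hc : m = 2 ∧ ε = -1
  · simp only [hc, and_self, if_true, true_imp_iff]
    decide
  · simp only [hc, if_false, false_imp_iff, and_true]
    decide

/-! ### Orbits of $H_2$ on the neighbours of $0$ -/

theorem orbit_eq_of_mem {g : VO m ε ≃g VO m ε} (hg : g ∈ H₂ m ε) (x : Vec m) :
    {z | ∃ h ∈ H₂ m ε, h (g x) = z} = {z | ∃ h ∈ H₂ m ε, h x = z} := by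
  ext z
  constructor
  · rintro ⟨h, hh, rfl⟩
    exact ⟨h * g, mul_mem hh hg, rfl⟩
  · rintro ⟨h, hh, rfl⟩
    exact ⟨h * g⁻¹, mul_mem hh (inv_mem hg), congrArg h (g.symm_apply_apply x)⟩

theorem e₁₂_eq (hm : 0 < m) :
    e₁₂ m = Pi.single (lo ⟨0, hm⟩) 1 + Pi.single (hi ⟨0, hm⟩) 1 := by
  funext ⟨j, hj⟩
  rcases j with _ | _ | j <;> simp [e₁₂, lo, hi]

theorem exists_mem_H₂ (hm : 0 < m) {x y : Vec m} (hx : (VO m ε).Adj 0 x)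
    (hy : (VO m ε).Adj 0 y) (h : polarForm m x (e₁₂ m) = polarForm m y (e₁₂ m)) :
    ∃ g ∈ H₂ m ε, g x = y := by
  rw [VO_adj, zero_add] at hx hy
  have he : quadForm m ε (e₁₂ m) = 1 := by rw [e₁₂_eq hm, quadForm_lo_add_hi]
  have hne {z : Vec m} (hz : quadForm m ε z = 0) : z ≠ e₁₂ m := by
    rintro rfl
    exact one_ne_zero (he.symm.trans hz)
  obtain ⟨g, h0, h1, h2⟩ := exists_iso_fixing (x := e₁₂ m) (hx.2.trans hy.2.symm)
    (by rwa [polarForm_comm, polarForm_comm (e₁₂ m)]) hx.1.symm hy.1.symm (hne hx.2) (hne hy.2)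
  exact ⟨g, ⟨h0, h1⟩, h2⟩

/-- Automorphisms need not be linear, but for singular $x$ the value $B(x,e_1+e_2)$ is determined by
the relation of $x$ to $e_1+e_2$. -/
theorem polarForm_eq_of_mem_H₂ {g : VO m ε ≃g VO m ε} (hg : g ∈ H₂ m ε) {x : Vec m}
    (hx : (VO m ε).Adj 0 x) : polarForm m (g x) (e₁₂ m) = polarForm m x (e₁₂ m) := by
  have hgx : (VO m ε).Adj 0 (g x) := by
    rw [← hg.1]
    exact g.map_adj_iff.2 hx
  have h := SimpleGraph.relType_map (VO m ε) g x (e₁₂ m)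
  rw [hg.2, relType_eq_zero_add, relType_eq_zero_add x] at h
  have hQ := (relType_zero_eq_iff.1 h).2
  rw [VO_adj, zero_add] at hgx hx
  rwa [quadForm_add, quadForm_add, hgx.2, hx.2, add_right_inj] at hQ

theorem ncard_orbitsH₂ (hm : 3 ≤ m) : (orbitsH₂ m ε).ncard = 2 := by
  have hm0 : 0 < m := by omega
  have adj_single (i : Fin m) (h : (i : ℕ) + 1 ≠ m) : (VO m ε).Adj 0 (Pi.single (lo i) 1) := by
    rw [VO_adj, zero_add]
    exact ⟨(single_ne_zero_vec _).symm, by simp [quadForm_single_lo, h]⟩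
  have ha := adj_single ⟨0, hm0⟩ (by simp only; omega)
  -- As `3 ≤ m`, the second pair is not the last one, so $e_3$ is singular for both signs.
  have hb := adj_single ⟨1, by omega⟩ (by simp only; omega)
  have hBa : polarForm m (Pi.single (lo ⟨0, hm0⟩) 1) (e₁₂ m) = 1 := by
    rw [polarForm_single_lo]
    simp [e₁₂, hi]
  have hBb : polarForm m (Pi.single (lo ⟨1, by omega⟩) 1) (e₁₂ m) = 0 := by
    rw [polarForm_single_lo]
    simp [e₁₂, hi]
  have key : orbitsH₂ m ε = {{z | ∃ g ∈ H₂ m ε, g (Pi.single (lo ⟨0, hm0⟩) 1) = z},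
      {z | ∃ g ∈ H₂ m ε, g (Pi.single (lo ⟨1, by omega⟩) 1) = z}} := by
    ext O
    simp only [orbitsH₂, Set.mem_ofPred_eq, Set.mem_insert_iff, Set.mem_singleton_iff]
    constructor
    · rintro ⟨x, hx, rfl⟩
      rcases eq_zero_or_one (polarForm m x (e₁₂ m)) with h | h
      · obtain ⟨g, hg, hgx⟩ := exists_mem_H₂ hm0 hx hb (h.trans hBb.symm)
        exact Or.inr (by rw [← hgx, orbit_eq_of_mem hg])
      · obtain ⟨g, hg, hgx⟩ := exists_mem_H₂ hm0 hx ha (h.trans hBa.symm)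
        exact Or.inl (by rw [← hgx, orbit_eq_of_mem hg])
    · rintro (rfl | rfl)
      exacts [⟨_, ha, rfl⟩, ⟨_, hb, rfl⟩]
  rw [key, Set.ncard_pair]
  intro h
  obtain ⟨g, hg, hga⟩ := h.le ⟨1, one_mem _, rfl⟩
  have := polarForm_eq_of_mem_H₂ hg hb
  rw [hga, hBb] at this
  exact one_ne_zero (hBa.symm.trans this)

end AffinePolar

theorem theorem3p6 (m : ℕ) (hm : 2 ≤ m) (ε : ℤˣ) :
    (AffinePolar.VO m ε).IsTriplyTransitive ∧
    (∀ ω : AffinePolar.Vec m,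
      Module.finrank ℂ ((AffinePolar.VO m ε).tripleSpan ω) =
        (if m = 2 ∧ ε = -1 then 14 else 15) ∧
      Module.finrank ℂ ((AffinePolar.VO m ε).stabilizerCentralizer ω) =
        (if m = 2 ∧ ε = -1 then 14 else 15)) ∧
    (3 ≤ m → (AffinePolar.orbitsH₂ m ε).ncard = 2) := by
  have hG := AffinePolar.VO_isTripleHomogeneous m ε
  refine ⟨hG.isTriplyTransitive, fun ω => ?_, AffinePolar.ncard_orbitsH₂⟩
  have h := (SimpleGraph.finrank_tripleSpan (G := AffinePolar.VO m ε) ω).trans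
    (AffinePolar.ncard_range_tripleType hm ω)
  refine ⟨h, ?_⟩
  rw [hG.tripleSpan_eq_stabilizerCentralizer] at h
  exact h
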